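/- Let $0<p\le 1$. There is a constant $C=C(p)<\infty$, depending only on $p$, such that the following holds. Let $\mathbb X$ be a $p$-Banach space over $\mathbb F=\mathbb R$ or $\mathbb C$ (a vector space, complete with respect to a quasi-norm satisfying $\|f+g\|^p\le\|f\|^p+\|g\|^p$), and let $\mathcal X=(x_n)_{n=1}^\infty$ be a fundamental minimal system for $\mathbb X$ with dual system $(x_n^*)_{n=1}^\infty$; that is, the linear span of $\mathcal X$ is dense in $\mathbb X$, the $x_n^*$ are continuous linear functionals, and $x_k^*(x_n)=\delta_{kn}$. Assume $\sup_n\|x_n\|<\infty$ and $\sup_n\|x_n^*\|<\infty$. Write $\operatorname{supp}(y)=\{n: x_n^*(y)\neq 0\}$ and $P_A(f)=\sum_{n\in A}x_n^*(f)x_n$ for finite $A\subset\mathbb N$. A finite set $A\subset\mathbb N$ is a greedy set of $f\in\mathbb X$ if $|x_n^*(f)|\ge|x_k^*(f)|$ for all $n\in A$, $k\notin A$. Let $A_0(f)=\emptyset$ and $A_m(f)=A_{m-1}(f)\cup\{k(m)\}$, where $k(m)$ is the least $n\notin A_{m-1}(f)$ with $|x_n^*(f)|=\max_{j\notin A_{m-1}(f)}|x_j^*(f)|$.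 For $m\ge 1$ let $\mathbf g_m$, $\boldsymbol\lambda_m$, $\mathbf L_m^{ch}$ be the smallest constants in $[0,\infty]$ such that, respectively: (a) $\|P_A(f)\|\le \mathbf g_m\|f\|$ for all $f\in\mathbb X$ and all greedy sets $A$ of $f$ with $|A|\le m$; (b) $\min_{n\in B}|x_n^*(f)|\,\bigl\|\sum_{n\in A}\varepsilon_n x_n\bigr\|\le\boldsymbol\lambda_m\|f\|$ for all $f\in\mathbb X$, all nonempty greedy sets $B$ of $f$, all $A\subset\mathbb N$ with $|A|=|B|\le m$, and all scalars $\varepsilon_n$ $(n\in A)$ with $|\varepsilon_n|=1$; (c) for all $f\in\mathbb X$, $$\inf_{(a_n)\subset\mathbb F}\Bigl\|f-\sum_{n\in A_m(f)}a_nx_n\Bigr\|\le \mathbf L_m^{ch}\,\inf\bigl\{\|f-y\| : y\in\operatorname{span}(\mathcal X),\ |\operatorname{supp}(y)|\le m\bigr\}.$$ Then for every $m\ge1$, $$\mathbf L_m^{ch}\le C\max\{\mathbf g_m,\boldsymbol\lambda_m\}\ \text{ if } p=1,\qquad \mathbf L_m^{ch}\le C\max\{\mathbf g_m^{1+1/p},\boldsymbol\lambda_m\}\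 \text{ if } p<1.$$ -/

import Mathlib

open scoped ENNReal NNReal

/-- `N` is a `p`-subadditive quasi-norm on the `𝕜`-vector space `X`, and `X` is complete for it,
i.e. `(X, N)` is a `p`-Banach space. -/
structure IsPBanach (𝕜 : Type*) [RCLike 𝕜] {X : Type*} [AddCommGroup X] [Module 𝕜 X]
    (p : ℝ) (N : X → ℝ) : Prop where
  nonneg : ∀ f, 0 ≤ N f
  eq_zero_iff : ∀ f, N f = 0 ↔ f = 0
  smul : ∀ (c : 𝕜) (f : X), N (c • f) = ‖c‖ * N f
  add_rpow_le : ∀ f g, N (f + g) ^ p ≤ N f ^ p + N g ^ p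
  complete : ∀ u : ℕ → X,
    (∀ ε > 0, ∃ K, ∀ i ≥ K, ∀ j ≥ K, N (u i - u j) < ε) →
      ∃ f, ∀ ε > 0, ∃ K, ∀ i ≥ K, N (u i - f) < ε

/-- `x` is a fundamental minimal system of `(X, N)` and `xs` is its dual system: the span of `x` is
dense, the functionals `xs n` are continuous (i.e. bounded), and `(x, xs)` is biorthogonal.
(By density of the span, `x` determines `xs`.) -/
structure IsFundamentalMinimalSystem {𝕜 : Type*} [RCLike 𝕜] {X : Type*} [AddCommGroup X]
    [Module 𝕜 X] (N : X → ℝ) (x : ℕ → X) (xs : ℕ → X →ₗ[𝕜] 𝕜) : Prop where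
  fundamental : ∀ f, ∀ ε > 0, ∃ g ∈ Submodule.span 𝕜 (Set.range x), N (f - g) < ε
  continuous_dual : ∀ n, ∃ M : ℝ, ∀ f, ‖xs n f‖ ≤ M * N f
  biorthogonal : ∀ k n, xs k (x n) = if k = n then 1 else 0

/-- The system and its dual system are (uniformly) bounded, the latter in the dual quasi-norm
`‖φ‖ = sup {|φ f| : N f ≤ 1}`. -/
def IsBoundedSystem {𝕜 : Type*} [RCLike 𝕜] {X : Type*} [AddCommGroup X] [Module 𝕜 X]
    (N : X → ℝ) (x : ℕ → X) (xs : ℕ → X →ₗ[𝕜] 𝕜) : Prop :=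
  (∃ M : ℝ, ∀ n, N (x n) ≤ M) ∧ (∃ M : ℝ, ∀ n f, ‖xs n f‖ ≤ M * N f)

section Greedy

variable {𝕜 : Type*} [RCLike 𝕜] {X : Type*} [AddCommGroup X] [Module 𝕜 X]

/-- The support of `f`: the set of indices of its nonzero coefficients. -/
def coeffSupport (xs : ℕ → X →ₗ[𝕜] 𝕜) (f : X) : Set ℕ := {n | xs n f ≠ 0}

/-- The projection `P_A f = ∑_{n ∈ A} xs n f • x n`. -/
def coordProj (x : ℕ → X) (xs : ℕ → X →ₗ[𝕜] 𝕜) (A : Finset ℕ) (f : X) : X :=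
  ∑ n ∈ A, xs n f • x n

/-- `A` is a greedy set of `f` (of order `A.card`). -/
def IsGreedySet (xs : ℕ → X →ₗ[𝕜] 𝕜) (f : X) (A : Finset ℕ) : Prop :=
  ∀ n ∈ A, ∀ k ∉ A, ‖xs k f‖ ≤ ‖xs n f‖

/-- The greedy set `A_m(f)` produced by the thresholding greedy algorithm: at each step one adds
the least index outside the current set at which the maximum of the moduli of the coefficients
outside that set is attained. (If the system and its dual are bounded, the coefficients
tend to zero, so this maximum is attained.) -/
noncomputable def thresholdingGreedySet (xs : ℕ → X →ₗ[𝕜] 𝕜) (f : X) : ℕ → Finset ℕ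
  | 0 => ∅
  | m + 1 =>
    insert
      (sInf {n : ℕ | n ∉ thresholdingGreedySet xs f m ∧
        ∀ j ∉ thresholdingGreedySet xs f m, ‖xs j f‖ ≤ ‖xs n f‖})
      (thresholdingGreedySet xs f m)

/-- The quasi-greedy parameter `g_m`: the smallest `C ∈ [0, ∞]` with `‖P_A f‖ ≤ C ‖f‖` for all `f`
and all greedy sets `A` of `f` with at most `m` elements. -/
noncomputable def quasiGreedyParam (N : X → ℝ) (x : ℕ → X) (xs : ℕ → X →ₗ[𝕜] 𝕜) (m : ℕ) : ℝ≥0∞ :=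
  sInf {C : ℝ≥0∞ | ∀ (f : X) (A : Finset ℕ), IsGreedySet xs f A → A.card ≤ m →
    ENNReal.ofReal (N (coordProj x xs A f)) ≤ C * ENNReal.ofReal (N f)}

/-- The squeeze symmetry parameter `λ_m`: the smallest `C ∈ [0, ∞]` with
`min_{n ∈ B} |xs n f| ‖∑_{n ∈ A} ε n • x n‖ ≤ C ‖f‖` for all `f`, all nonempty greedy sets `B` of
`f`, all `A` with `|A| = |B| ≤ m`, and all unimodular `ε`. -/
noncomputable def squeezeSymmetryParam (N : X → ℝ) (x : ℕ → X) (xs : ℕ → X →ₗ[𝕜] 𝕜)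
    (m : ℕ) : ℝ≥0∞ :=
  sInf {C : ℝ≥0∞ | ∀ (f : X) (A B : Finset ℕ) (ε : ℕ → 𝕜) (hB : B.Nonempty),
    IsGreedySet xs f B → B.card = A.card → A.card ≤ m → (∀ n ∈ A, ‖ε n‖ = 1) →
    ENNReal.ofReal (B.inf' hB (fun n => ‖xs n f‖) * N (∑ n ∈ A, ε n • x n))
      ≤ C * ENNReal.ofReal (N f)}

/-- The error `‖f - CG_m(f)‖ = inf_a ‖f - ∑_{n ∈ A_m(f)} a n • x n‖` of the Chebyshev thresholding
greedy algorithm. -/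
noncomputable def chebyshevGreedyError (N : X → ℝ) (x : ℕ → X) (xs : ℕ → X →ₗ[𝕜] 𝕜)
    (m : ℕ) (f : X) : ℝ≥0∞ :=
  ⨅ a : ℕ → 𝕜, ENNReal.ofReal (N (f - ∑ n ∈ thresholdingGreedySet xs f m, a n • x n))

/-- The error of best `m`-term approximation, `inf ‖f - y‖` over all `y` in the linear span of the
system with `|supp y| ≤ m`. -/
noncomputable def bestTermError (N : X → ℝ) (x : ℕ → X) (xs : ℕ → X →ₗ[𝕜] 𝕜)
    (m : ℕ) (f : X) : ℝ≥0∞ :=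
  ⨅ (y : X) (_ : y ∈ Submodule.span 𝕜 (Set.range x) ∧ (coeffSupport xs y).encard ≤ m),
    ENNReal.ofReal (N (f - y))

/-- The Chebyshev-greedy Lebesgue parameter `L_m^{ch}`, as an element of `[0, ∞]`. -/
noncomputable def chebyshevLebesgueParam (N : X → ℝ) (x : ℕ → X) (xs : ℕ → X →ₗ[𝕜] 𝕜)
    (m : ℕ) : ℝ≥0∞ :=
  sInf {C : ℝ≥0∞ | ∀ f : X, chebyshevGreedyError N x xs m f ≤ C * bestTermError N x xs m f}

end Greedy

/-! Put `h = f - y`, let `A` be the greedy set of `f`, `B` the support of `y`, and `t` the least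
modulus of a coefficient of `f` on `A`. Off `B` the vectors `h` and `f` have the same coefficients,
so those of `h` are at most `t` off `A ∪ B` and at least `t` on `A \ B`.
`exists_greedySet_subset_union` removes a greedy set `D ⊆ A ∪ B` of `h`, leaving coefficients at
most some `s ≥ t`. With `c` the coefficients of `P_D h + y`, `f - ∑_A c_n x_n = h - P_D h + ∑_{B \
A} c_n x_n`. Here `g_m` controls `P_D h`; since `|c_n| ≤ 2s` on `B \ A` and `h` has at least `|B \
A|` coefficients of modulus at least `s`, `λ_m` controls the last sum (`norm_sum_smul_rpow_le`). The
bound is linear for every `p`; the power of `g_m` enters only through `g_m ≥ 1`. -/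

section CoefficientBounds

variable {𝕜 : Type*} [RCLike 𝕜] {X : Type*} [AddCommGroup X] [Module 𝕜 X]
  {N : X → ℝ} {x : ℕ → X} {xs : ℕ → X →ₗ[𝕜] 𝕜} {p : ℝ}

/-! ### From unimodular to bounded coefficients -/

/-- A scalar of modulus at most one is within `1 / 2` of half a unimodular scalar. -/
theorem exists_unimodular_near (c : 𝕜) (hc : ‖c‖ ≤ 1) :
    ∃ e : 𝕜, ‖e‖ = 1 ∧ ‖2 * c - e‖ ≤ 1 := by
  by_cases h0 : c = 0
  · exact ⟨1, by simp, by simp [h0]⟩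
  · have hn : ‖c‖ ≠ 0 := norm_ne_zero_iff.2 h0
    refine ⟨((‖c‖⁻¹ : ℝ) : 𝕜) * c, ?_, ?_⟩
    · rw [norm_mul, RCLike.norm_ofReal, abs_of_nonneg (by positivity), inv_mul_cancel₀ hn]
    · have : 2 * c - ((‖c‖⁻¹ : ℝ) : 𝕜) * c = ((2 - ‖c‖⁻¹ : ℝ) : 𝕜) * c := by
        push_cast; ring
      rw [this, norm_mul, RCLike.norm_ofReal]
      rw [← abs_norm c, ← abs_mul, abs_norm, sub_mul, inv_mul_cancel₀ hn, abs_le]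
      constructor <;> linarith [norm_nonneg c]

namespace IsPBanach

theorem map_zero (h : IsPBanach 𝕜 p N) : N 0 = 0 := (h.eq_zero_iff 0).2 rfl

theorem map_neg (h : IsPBanach 𝕜 p N) (f : X) : N (-f) = N f := by
  simpa using h.smul (-1) f

theorem sub_rpow_le (h : IsPBanach 𝕜 p N) (f g : X) : N (f - g) ^ p ≤ N f ^ p + N g ^ p := by
  simpa [sub_eq_add_neg, h.map_neg] using h.add_rpow_le f (-g)

theorem sum_rpow_le (h : IsPBanach 𝕜 p N) (hp : 0 < p) (E : Finset ℕ) (y : ℕ → X) :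
    N (∑ n ∈ E, y n) ^ p ≤ ∑ n ∈ E, N (y n) ^ p := by
  classical
  induction E using Finset.induction_on with
  | empty => simp [h.map_zero, Real.zero_rpow hp.ne']
  | insert a E ha ih =>
    rw [Finset.sum_insert ha, Finset.sum_insert ha]
    exact (h.add_rpow_le _ _).trans (by gcongr)

/-- Sums with coefficients in the unit ball are controlled by sums with unimodular coefficients. -/
theorem sum_smul_rpow_le (h : IsPBanach 𝕜 p N) (hp : 0 < p) (E : Finset ℕ) {M : ℝ}
    (hM : ∀ e : ℕ → 𝕜, (∀ n ∈ E, ‖e n‖ = 1) → N (∑ n ∈ E, e n • x n) ^ p ≤ M)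
    (c : ℕ → 𝕜) (hc : ∀ n ∈ E, ‖c n‖ ≤ 1) :
    N (∑ n ∈ E, c n • x n) ^ p ≤ M / (2 ^ p - 1) := by
  have h2 : (1 : ℝ) < 2 ^ p := Real.one_lt_rpow (by norm_num) hp
  set q : ℝ := (2 ^ p)⁻¹ with hq
  have hq0 : 0 < q := by positivity
  have hq1 : q < 1 := inv_lt_one_of_one_lt₀ h2
  set F : ℝ := ∑ n ∈ E, N (x n) ^ p
  have hM0 : 0 ≤ M := (Real.rpow_nonneg (h.nonneg _) p).trans (hM (fun _ => 1) (by simp))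
  -- Binary expansion: each step halves a unimodular sum plus a sum of the same kind. The bound `M /
  -- (2 ^ p - 1)` is the fixed point of `T ↦ q * (M + T)`, and the crude initial error `F` decays
  -- like `q ^ j`.
  have key : ∀ j : ℕ, ∀ c : ℕ → 𝕜, (∀ n ∈ E, ‖c n‖ ≤ 1) →
      N (∑ n ∈ E, c n • x n) ^ p ≤ M / (2 ^ p - 1) + q ^ j * F := by
    intro j
    induction j with
    | zero =>
      intro c hc
      have hF : N (∑ n ∈ E, c n • x n) ^ p ≤ F := by
        refine (h.sum_rpow_le hp E _).trans (Finset.sum_le_sum fun n hn => ?_)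
        refine Real.rpow_le_rpow (h.nonneg _) ?_ hp.le
        rw [h.smul]
        exact mul_le_of_le_one_left (h.nonneg _) (hc n hn)
      have : 0 ≤ M / (2 ^ p - 1) := div_nonneg hM0 (by linarith)
      simpa using by linarith
    | succ j ih =>
      intro c hc
      choose! e he1 he2 using fun n (hn : n ∈ E) => exists_unimodular_near (c n) (hc n hn)
      have hsplit : ∑ n ∈ E, c n • x n =
          (2⁻¹ : 𝕜) • (∑ n ∈ E, e n • x n + ∑ n ∈ E, (2 * c n - e n) • x n) := by
        rw [← Finset.sum_add_distrib, Finset.smul_sum]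
        refine Finset.sum_congr rfl fun n _ => ?_
        rw [← add_smul, smul_smul]
        congr 1
        ring
      rw [hsplit, h.smul, Real.mul_rpow (norm_nonneg _) (h.nonneg _)]
      have hq' : ‖(2⁻¹ : 𝕜)‖ ^ p = q := by
        rw [norm_inv, RCLike.norm_ofNat, Real.inv_rpow (by norm_num)]
      rw [hq']
      calc q * N (∑ n ∈ E, e n • x n + ∑ n ∈ E, (2 * c n - e n) • x n) ^ p
          ≤ q * (M + (M / (2 ^ p - 1) + q ^ j * F)) := by
            gcongr
            exact (h.add_rpow_le _ _).trans (add_le_add (hM e he1) (ih _ he2))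
        _ = M / (2 ^ p - 1) + q ^ (j + 1) * F := by
            have : (2 : ℝ) ^ p - 1 ≠ 0 := by linarith
            rw [pow_succ, hq]
            field_simp
            ring
  have hlim : Filter.Tendsto (fun j : ℕ => M / (2 ^ p - 1) + q ^ j * F) Filter.atTop
      (nhds (M / (2 ^ p - 1) + 0 * F)) :=
    ((tendsto_pow_atTop_nhds_zero_of_lt_one hq0.le hq1).mul_const F).const_add _
  simpa using ge_of_tendsto' hlim fun j => key j c hc

end IsPBanach

/-! ### Existence and comparison of greedy sets -/

section GreedySets

/-- Approximate `f` by `g` in the span: off the finite support of `g`, the coefficients of `f` are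
those of `f - g`, hence below `r`. -/
theorem finite_setOf_le_norm_coeff (hX : IsPBanach 𝕜 p N) (hF : IsFundamentalMinimalSystem N x xs)
    (hb : IsBoundedSystem N x xs) (f : X) {r : ℝ} (hr : 0 < r) :
    {n | r ≤ ‖xs n f‖}.Finite := by
  obtain ⟨M, hM⟩ := hb.2
  have hM' : ∀ n f, ‖xs n f‖ ≤ (|M| + 1) * N f := fun n f =>
    (hM n f).trans (mul_le_mul_of_nonneg_right (by linarith [le_abs_self M]) (hX.nonneg f))
  obtain ⟨g, hg, hfg⟩ := hF.fundamental f (r / (|M| + 1)) (by positivity)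
  have hfin : ∀ g ∈ Submodule.span 𝕜 (Set.range x), {n | xs n g ≠ 0}.Finite := by
    intro g hg
    induction hg using Submodule.span_induction with
    | mem y hy =>
      obtain ⟨k, rfl⟩ := hy
      refine (Set.finite_singleton k).subset fun n hn => ?_
      by_contra hne
      exact hn (by rw [hF.biorthogonal]; exact if_neg hne)
    | zero => simp
    | add a b _ _ ha hb =>
      refine (ha.union hb).subset fun n hn => ?_
      by_contra hne
      simp only [Set.mem_union, Set.mem_ofPred_eq, not_or, not_not] at hne
      exact hn (by rw [_root_.map_add, hne.1, hne.2, add_zero])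
    | smul c a _ ha =>
      refine ha.subset fun n hn hne => hn ?_
      rw [_root_.map_smul, hne, smul_zero]
  refine (hfin g hg).subset fun n hn hne => ?_
  have h1 := hM' n (f - g)
  rw [map_sub, hne, sub_zero] at h1
  have h2 : (|M| + 1) * N (f - g) < r := by
    rw [lt_div_iff₀ (by positivity)] at hfg
    linarith
  exact (h1.trans_lt h2).not_ge hn

/-- Ensures that the `sInf` in `thresholdingGreedySet` is over a nonempty set, not the default value
`0`. -/
theorem exists_max_coeff_compl (hX : IsPBanach 𝕜 p N) (hF : IsFundamentalMinimalSystem N x xs)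
    (hb : IsBoundedSystem N x xs) (f : X) (A : Finset ℕ) :
    ∃ n, n ∉ A ∧ ∀ j ∉ A, ‖xs j f‖ ≤ ‖xs n f‖ := by
  by_cases h0 : ∀ j ∉ A, ‖xs j f‖ ≤ 0
  · obtain ⟨n, hn⟩ := Infinite.exists_notMem_finset A
    exact ⟨n, hn, fun j hj => (h0 j hj).trans (norm_nonneg _)⟩
  · push Not at h0
    obtain ⟨k, hk, hk0⟩ := h0
    have hfin : ({n | ‖xs k f‖ ≤ ‖xs n f‖} \ (A : Set ℕ)).Finite :=
      (finite_setOf_le_norm_coeff hX hF hb f hk0).subset Set.sdiff_subset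
    obtain ⟨n, hn, hmax⟩ := Set.exists_max_image _ (fun n => ‖xs n f‖) hfin
      ⟨k, le_refl ‖xs k f‖, by simpa using hk⟩
    refine ⟨n, by simpa using hn.2, fun j hj => ?_⟩
    by_cases hjk : ‖xs k f‖ ≤ ‖xs j f‖
    · exact hmax j ⟨hjk, by simpa using hj⟩
    · exact (not_le.1 hjk).le.trans hn.1

theorem thresholdingGreedySet_spec (hX : IsPBanach 𝕜 p N) (hF : IsFundamentalMinimalSystem N x xs)
    (hb : IsBoundedSystem N x xs) (f : X) (m : ℕ) :
    IsGreedySet xs f (thresholdingGreedySet xs f m) ∧ (thresholdingGreedySet xs f m).card = m := by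
  induction m with
  | zero => exact ⟨by simp [IsGreedySet, thresholdingGreedySet], rfl⟩
  | succ m ih =>
    obtain ⟨hk, hmax⟩ := Nat.sInf_mem
      (s := {n : ℕ | n ∉ thresholdingGreedySet xs f m ∧
        ∀ j ∉ thresholdingGreedySet xs f m, ‖xs j f‖ ≤ ‖xs n f‖})
      (exists_max_coeff_compl hX hF hb f _)
    rw [thresholdingGreedySet]
    refine ⟨fun n hn k hk' => ?_, by rw [Finset.card_insert_of_notMem hk, ih.2]⟩
    have hk'' := fun hmem => hk' (Finset.mem_insert_of_mem hmem)
    rcases Finset.mem_insert.1 hn with rfl | hn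
    · exact hmax k hk''
    · exact ih.1 n hn k hk''

/-- An element of `D` with coefficient below `s` would force `S` into `D` minus that element, which
is too small. -/
theorem IsGreedySet.le_of_card_le {h : X} {D S : Finset ℕ} {s : ℝ} (hD : IsGreedySet xs h D)
    (hcard : D.card ≤ S.card) (hS : ∀ n ∈ S, s ≤ ‖xs n h‖) : ∀ n ∈ D, s ≤ ‖xs n h‖ := by
  intro n hn
  by_contra! hlt
  have hSD : S ⊆ D.erase n := fun k hk => by
    refine Finset.mem_erase.2 ⟨?_, ?_⟩
    · rintro rfl
      exact absurd (hS k hk) hlt.not_ge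
    · by_contra hkD
      linarith [hD n hn k hkD, hS k hk]
  have h1 := Finset.card_le_card hSD
  have h2 := Finset.card_erase_lt_of_mem hn
  omega

theorem IsGreedySet.lt_of_card_lt {h : X} {D S : Finset ℕ} {t : ℝ} (hD : IsGreedySet xs h D)
    (hcard : D.card < S.card) (hS : ∀ n ∈ S, t < ‖xs n h‖) : ∀ n ∈ D, t < ‖xs n h‖ := by
  intro n hn
  obtain ⟨k, hk, hkD⟩ := Finset.exists_mem_notMem_of_card_lt_card hcard
  exact (hS k hk).trans_le (hD n hn k hkD)

end GreedySets

/-! ### Inequalities satisfied by the parameters -/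

section Parameters

theorem le_sInf_mul_of_forall {S : Set ℝ≥0∞} {a b : ℝ≥0∞} (hb : b ≠ ⊤) (ha : b = 0 → a = 0)
    (h : ∀ C ∈ S, a ≤ C * b) : a ≤ sInf S * b := by
  by_cases hb0 : b = 0
  · simp [ha hb0]
  · rw [← ENNReal.div_le_iff_le_mul (Or.inl hb0) (Or.inl hb)]
    exact le_sInf fun C hC => ENNReal.div_le_of_le_mul (h C hC)

theorem IsPBanach.eq_zero_of_ofReal_eq_zero (hX : IsPBanach 𝕜 p N) {f : X}
    (h : ENNReal.ofReal (N f) = 0) : f = 0 :=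
  (hX.eq_zero_iff f).1 (le_antisymm (ENNReal.ofReal_eq_zero.1 h) (hX.nonneg f))

theorem norm_coordProj_le (hX : IsPBanach 𝕜 p N) {m : ℕ} {f : X} {A : Finset ℕ}
    (hA : IsGreedySet xs f A) (hm : A.card ≤ m) :
    ENNReal.ofReal (N (coordProj x xs A f)) ≤
      quasiGreedyParam N x xs m * ENNReal.ofReal (N f) := by
  refine le_sInf_mul_of_forall ENNReal.ofReal_ne_top (fun h => ?_) fun C hC => hC f A hA hm
  simp [hX.eq_zero_of_ofReal_eq_zero h, coordProj, hX.map_zero]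

theorem inf_mul_norm_unimodular_sum_le (hX : IsPBanach 𝕜 p N) {m : ℕ} {f : X} {A B : Finset ℕ}
    {ε : ℕ → 𝕜} (hB : B.Nonempty) (hg : IsGreedySet xs f B) (hc : B.card = A.card)
    (hm : A.card ≤ m) (hε : ∀ n ∈ A, ‖ε n‖ = 1) :
    ENNReal.ofReal (B.inf' hB (fun n => ‖xs n f‖) * N (∑ n ∈ A, ε n • x n)) ≤
      squeezeSymmetryParam N x xs m * ENNReal.ofReal (N f) := by
  refine le_sInf_mul_of_forall ENNReal.ofReal_ne_top (fun h => ?_)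
    fun C hC => hC f A B ε hB hg hc hm hε
  have : B.inf' hB (fun n => ‖xs n f‖) = 0 := by
    simp [hX.eq_zero_of_ofReal_eq_zero h]
  simp [this]

theorem one_le_quasiGreedyParam (hX : IsPBanach 𝕜 p N) (hF : IsFundamentalMinimalSystem N x xs)
    {m : ℕ} (hm : 1 ≤ m) : 1 ≤ quasiGreedyParam N x xs m := by
  refine le_sInf fun C hC => ?_
  have hg : IsGreedySet xs (x 0) {0} := by
    intro n hn k hk
    have hk' : k ≠ 0 := by simpa using hk
    simp [hF.biorthogonal, hk']
  have h := hC (x 0) {0} hg (by simpa using hm)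
  have hP : coordProj x xs {0} (x 0) = x 0 := by simp [coordProj, hF.biorthogonal]
  rw [hP] at h
  have hne : ENNReal.ofReal (N (x 0)) ≠ 0 := fun h0 => by
    have h1 := hF.biorthogonal 0 0
    rw [hX.eq_zero_of_ofReal_eq_zero h0] at h1
    simp at h1
  simpa [ENNReal.div_self hne ENNReal.ofReal_ne_top] using ENNReal.div_le_of_le_mul h

/-- Squeeze symmetry for arbitrary coefficients of bounded modulus. -/
theorem norm_sum_smul_rpow_le (hX : IsPBanach 𝕜 p N) (hF : IsFundamentalMinimalSystem N x xs)
    (hb : IsBoundedSystem N x xs) (hp : 0 < p) {m : ℕ} {R : ℝ} (hR : 0 ≤ R)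
    (hlam : squeezeSymmetryParam N x xs m ≤ ENNReal.ofReal R) {h : X} {E S : Finset ℕ} {s : ℝ}
    (hs : 0 ≤ s) (hES : E.card ≤ S.card) (hEm : E.card ≤ m) (hS : ∀ n ∈ S, s ≤ ‖xs n h‖)
    {c : ℕ → 𝕜} (hc : ∀ n ∈ E, ‖c n‖ ≤ 2 * s) :
    N (∑ n ∈ E, c n • x n) ^ p ≤ (2 * (R * N h)) ^ p / (2 ^ p - 1) := by
  have h2 : (1 : ℝ) < 2 ^ p := Real.one_lt_rpow (by norm_num) hp
  have hRN : 0 ≤ R * N h := mul_nonneg hR (hX.nonneg h)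
  have hzero : ∀ y : X, y = 0 → N y ^ p ≤ (2 * (R * N h)) ^ p / (2 ^ p - 1) := by
    rintro y rfl
    rw [hX.map_zero, Real.zero_rpow hp.ne']
    exact div_nonneg (by positivity) (by linarith)
  rcases E.eq_empty_or_nonempty with rfl | hE
  · exact hzero _ Finset.sum_empty
  rcases hs.eq_or_lt with rfl | hs
  · refine hzero _ (Finset.sum_eq_zero fun n hn => ?_)
    rw [norm_le_zero_iff.1 ((hc n hn).trans_eq (mul_zero _)), zero_smul]
  -- `S` need not be greedy; a greedy set of `h` of size exactly `|E|` replaces it, with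
  -- coefficients still at least `s`.
  obtain ⟨hD, hDc⟩ := thresholdingGreedySet_spec hX hF hb h E.card
  set D := thresholdingGreedySet xs h E.card
  have hDne : D.Nonempty := Finset.card_pos.1 (hDc ▸ hE.card_pos)
  have hsinf : s ≤ D.inf' hDne (fun n => ‖xs n h‖) :=
    Finset.le_inf' _ _ (hD.le_of_card_le (hDc.trans_le hES) hS)
  have hunim : ∀ e : ℕ → 𝕜, (∀ n ∈ E, ‖e n‖ = 1) →
      N (∑ n ∈ E, e n • x n) ^ p ≤ (R * N h / s) ^ p := by
    intro e he
    refine Real.rpow_le_rpow (hX.nonneg _) ?_ hp.le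
    rw [le_div_iff₀ hs]
    have h1 := (inf_mul_norm_unimodular_sum_le (x := x) hX hDne hD hDc hEm he).trans
      (mul_le_mul_left hlam (ENNReal.ofReal (N h)))
    rw [← ENNReal.ofReal_mul hR, ENNReal.ofReal_le_ofReal_iff hRN] at h1
    rw [mul_comm]
    exact (mul_le_mul_of_nonneg_right hsinf (hX.nonneg _)).trans h1
  have hscale : ∑ n ∈ E, c n • x n =
      ((2 * s : ℝ) : 𝕜) • ∑ n ∈ E, ((((2 * s)⁻¹ : ℝ) : 𝕜) * c n) • x n := by
    rw [Finset.smul_sum]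
    refine Finset.sum_congr rfl fun n _ => ?_
    rw [smul_smul, ← mul_assoc, ← RCLike.ofReal_mul, mul_inv_cancel₀ (by positivity)]
    simp
  have hmain := hX.sum_smul_rpow_le hp E hunim (fun n => (((2 * s)⁻¹ : ℝ) : 𝕜) * c n)
    fun n hn => by
      rw [norm_mul, RCLike.norm_ofReal, abs_of_nonneg (by positivity), inv_mul_le_iff₀ (by positivity)]
      simpa using hc n hn
  rw [hscale, hX.smul, RCLike.norm_ofReal, abs_of_nonneg (by positivity),
    Real.mul_rpow (by positivity) (hX.nonneg _)]
  calc (2 * s) ^ p * N (∑ n ∈ E, ((((2 * s)⁻¹ : ℝ) : 𝕜) * c n) • x n) ^ p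
      ≤ (2 * s) ^ p * ((R * N h / s) ^ p / (2 ^ p - 1)) := by gcongr
    _ = (2 * (R * N h)) ^ p / (2 ^ p - 1) := by
      rw [← mul_div_assoc, ← Real.mul_rpow (by positivity) (by positivity)]
      congr 2
      field_simp

end Parameters

theorem IsFundamentalMinimalSystem.coordProj_eq (hF : IsFundamentalMinimalSystem N x xs) {y : X}
    (hy : y ∈ Submodule.span 𝕜 (Set.range x)) {B : Finset ℕ} (hB : ∀ n ∉ B, xs n y = 0) :
    y = ∑ n ∈ B, xs n y • x n := by
  obtain ⟨a, rfl⟩ := (Finsupp.mem_span_range_iff_exists_finsupp).1 hy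
  have hco : ∀ k, xs k (a.sum fun i c => c • x i) = a k := by
    intro k
    rw [Finsupp.sum, map_sum]
    simp [hF.biorthogonal, Finsupp.mem_support_iff]
    exact fun h => h.symm
  simp only [hco] at hB ⊢
  exact Finset.sum_subset (fun n hn => by
    by_contra h; exact (Finsupp.mem_support_iff.1 hn) (hB n h))
    fun n _ hn => by simp [Finsupp.notMem_support_iff.1 hn]

/-! ### Construction of the Chebyshev approximant -/

/-- The set to be removed from `h = f - y`, and the threshold it determines. -/
theorem exists_greedySet_subset_union (hX : IsPBanach 𝕜 p N)
    (hF : IsFundamentalMinimalSystem N x xs) (hb : IsBoundedSystem N x xs) {m : ℕ} (hm : 1 ≤ m)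
    {h : X} {A B : Finset ℕ} (hA : A.card = m) (hB : B.card ≤ m) {t : ℝ}
    (hAB : ∀ n ∈ A \ B, t ≤ ‖xs n h‖) (hout : ∀ n ∉ A ∪ B, ‖xs n h‖ ≤ t) :
    ∃ (D S : Finset ℕ) (s : ℝ), D ⊆ A ∪ B ∧ IsGreedySet xs h D ∧ D.card ≤ m ∧ t ≤ s ∧
      (∀ n ∉ D, ‖xs n h‖ ≤ s) ∧ (B \ A).card ≤ S.card ∧ ∀ n ∈ S, s ≤ ‖xs n h‖ := by
  have hcard : (B \ A).card ≤ (A \ B).card :=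
    Finset.card_sdiff_le_card_sdiff_iff.2 (hB.trans hA.ge)
  set G := (A ∪ B).filter fun n => t < ‖xs n h‖ with hG
  have hGout : ∀ n ∉ G, ‖xs n h‖ ≤ t := by
    intro n hn
    by_contra! hlt
    exact hn (Finset.mem_filter.2 ⟨by by_contra hc; exact absurd (hout n hc) hlt.not_ge, hlt⟩)
  have hGin : ∀ n ∈ G, t < ‖xs n h‖ := fun n hn => (Finset.mem_filter.1 hn).2
  -- If `G` is too large for `g_m`, the `m` largest coefficients of `h` all exceed `t`, so their
  -- indices stay in `A ∪ B`; their minimum becomes `s`, and they serve as `S` too.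
  by_cases hGm : G.card ≤ m
  · exact ⟨G, A \ B, t, Finset.filter_subset _ _,
      fun n hn k hk => (hGout k hk).trans (hGin n hn).le, hGm, le_rfl, hGout, hcard, hAB⟩
  · obtain ⟨hD, hDc⟩ := thresholdingGreedySet_spec hX hF hb h m
    set D := thresholdingGreedySet xs h m
    have hDne : D.Nonempty := Finset.card_pos.1 (by omega)
    have hlt := hD.lt_of_card_lt (S := G) (by omega) hGin
    obtain ⟨k, hk, hkeq⟩ := Finset.exists_mem_eq_inf' hDne fun n => ‖xs n h‖
    refine ⟨D, D, ‖xs k h‖, fun n hn => ?_, hD, hDc.le, (hlt k hk).le, hD k hk, ?_, fun n hn => ?_⟩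
    · by_contra hc
      exact absurd (hout n hc) (hlt n hn).not_ge
    · exact hcard.trans ((Finset.card_le_card Finset.sdiff_subset).trans (hA.trans hDc.symm).le)
    · exact hkeq ▸ Finset.inf'_le _ hn

theorem exists_chebyshev_approx (hX : IsPBanach 𝕜 p N) (hF : IsFundamentalMinimalSystem N x xs)
    (hb : IsBoundedSystem N x xs) (hp : 0 < p) {m : ℕ} (hm : 1 ≤ m) {R : ℝ} (hR : 1 ≤ R)
    (hg : quasiGreedyParam N x xs m ≤ ENNReal.ofReal R)
    (hlam : squeezeSymmetryParam N x xs m ≤ ENNReal.ofReal R) (f y : X)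
    (hy : y ∈ Submodule.span 𝕜 (Set.range x)) (hym : (coeffSupport xs y).encard ≤ m) :
    ∃ a : ℕ → 𝕜, N (f - ∑ n ∈ thresholdingGreedySet xs f m, a n • x n) ≤
      (2 + 2 ^ p / (2 ^ p - 1)) ^ (1 / p) * R * N (f - y) := by
  have h2 : (1 : ℝ) < 2 ^ p := Real.one_lt_rpow (by norm_num) hp
  have hR0 : 0 ≤ R := zero_le_one.trans hR
  have hfin : (coeffSupport xs y).Finite :=
    Set.finite_of_encard_le_coe hym
  obtain ⟨B, hBeq⟩ := hfin.exists_finset_coe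
  have hB : B.card ≤ m := by
    rw [← hBeq, Set.encard_coe_eq_coe_finsetCard] at hym
    exact_mod_cast hym
  have hBy : ∀ n ∉ B, xs n y = 0 := by
    intro n hn
    by_contra hne
    exact hn (Finset.mem_coe.1 (hBeq ▸ hne))
  obtain ⟨hAg, hAc⟩ := thresholdingGreedySet_spec hX hF hb f m
  set A := thresholdingGreedySet xs f m
  obtain ⟨k, hk, hkmin⟩ := Finset.exists_min_image A (fun n => ‖xs n f‖)
    (Finset.card_pos.1 (by omega))
  set h := f - y with hh
  have hcoef : ∀ n ∉ B, xs n h = xs n f := fun n hn => by rw [hh, map_sub, hBy n hn, sub_zero]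
  obtain ⟨D, S, s, hDsub, hDg, hDm, hts, hDs, hES, hS⟩ :=
    exists_greedySet_subset_union hX hF hb hm (h := h) (t := ‖xs k f‖) hAc hB
      (fun n hn => by
        rw [Finset.mem_sdiff] at hn
        rw [hcoef n hn.2]
        exact hkmin n hn.1)
      (fun n hn => by
        rw [Finset.mem_union, not_or] at hn
        rw [hcoef n hn.2]
        exact hAg k hk n hn.1)
  set b : ℕ → 𝕜 := fun n => if n ∈ D then xs n h else 0 with hbdef
  set c : ℕ → 𝕜 := fun n => b n + xs n y with hcdef
  have hs0 : 0 ≤ s := (norm_nonneg _).trans hts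
  -- On `D` the coefficient is that of `f`; off `D` it is that of `f` minus that of `h`, each at
  -- most `s`.
  have hcn : ∀ n ∈ B \ A, ‖c n‖ ≤ 2 * s := by
    intro n hn
    have hft : ‖xs n f‖ ≤ s := (hAg k hk n (Finset.mem_sdiff.1 hn).2).trans hts
    by_cases hnD : n ∈ D
    · have : c n = xs n f := by simp [hcdef, hbdef, hnD, hh]
      rw [this]; linarith
    · have : c n = xs n f - xs n h := by simp [hcdef, hbdef, hnD, hh]
      rw [this]
      exact (norm_sub_le _ _).trans (by linarith [hDs n hnD])
  have hPD : coordProj x xs D h = ∑ n ∈ A ∪ B, b n • x n := by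
    rw [coordProj, ← Finset.sum_subset hDsub (fun n _ hn => by simp [hbdef, hn])]
    exact Finset.sum_congr rfl fun n hn => by simp [hbdef, hn]
  have hyexp : y = ∑ n ∈ A ∪ B, xs n y • x n := hF.coordProj_eq hy fun n hn =>
    hBy n fun hnB => hn (Finset.mem_union_right _ hnB)
  refine ⟨c, ?_⟩
  have hv : f - ∑ n ∈ A, c n • x n =
      h - coordProj x xs D h + ∑ n ∈ B \ A, c n • x n := by
    have hsum : ∑ n ∈ A, c n • x n + ∑ n ∈ B \ A, c n • x n = coordProj x xs D h + y := by
      rw [← Finset.sum_union Finset.disjoint_sdiff, Finset.union_sdiff_self_eq_union, hPD]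
      conv_rhs => rw [hyexp]
      rw [← Finset.sum_add_distrib]
      exact Finset.sum_congr rfl fun n _ => add_smul _ _ _
    rw [hh, sub_sub, add_comm y, ← hh, ← hsum]
    abel
  have hPDn : N (coordProj x xs D h) ≤ R * N h := by
    have h1 := (norm_coordProj_le (x := x) hX hDg hDm).trans
      (mul_le_mul_left hg (ENNReal.ofReal (N h)))
    rwa [← ENNReal.ofReal_mul hR0,
      ENNReal.ofReal_le_ofReal_iff (mul_nonneg hR0 (hX.nonneg h))] at h1
  have hE := norm_sum_smul_rpow_le hX hF hb hp hR0 hlam hs0 hES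
    ((Finset.card_le_card Finset.sdiff_subset).trans hB) hS hcn
  have hh0 := hX.nonneg h
  have hhR : N h ≤ R * N h := le_mul_of_one_le_left hh0 hR
  have hK : 0 ≤ 2 + 2 ^ p / ((2 : ℝ) ^ p - 1) :=
    add_nonneg zero_le_two (div_nonneg (by positivity) (by linarith))
  have hpow : N (f - ∑ n ∈ A, c n • x n) ^ p ≤
      (2 + 2 ^ p / (2 ^ p - 1)) * (R * N h) ^ p := by
    rw [hv]
    calc _ ≤ N h ^ p + N (coordProj x xs D h) ^ p + N (∑ n ∈ B \ A, c n • x n) ^ p :=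
          (hX.add_rpow_le _ _).trans (by gcongr; exact hX.sub_rpow_le _ _)
      _ ≤ (R * N h) ^ p + (R * N h) ^ p + (2 * (R * N h)) ^ p / (2 ^ p - 1) := by
          have h1 := Real.rpow_le_rpow hh0 hhR hp.le
          have h3 := Real.rpow_le_rpow (hX.nonneg _) hPDn hp.le
          linarith
      _ = (2 + 2 ^ p / (2 ^ p - 1)) * (R * N h) ^ p := by
          rw [Real.mul_rpow zero_le_two (mul_nonneg hR0 hh0)]
          ring
  have hroot := Real.rpow_le_rpow (Real.rpow_nonneg (hX.nonneg _) p) hpow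
    (one_div_nonneg.2 hp.le)
  rw [Real.mul_rpow hK (by positivity), ← Real.rpow_mul (hX.nonneg _),
    ← Real.rpow_mul (mul_nonneg hR0 hh0), mul_one_div_cancel hp.ne', Real.rpow_one,
    Real.rpow_one, ← mul_assoc] at hroot
  exact hroot

/-! ### Passage to the Lebesgue parameter -/

/-- The linear bound for the Chebyshev-greedy Lebesgue parameter, valid for all `p`. -/
theorem chebyshevLebesgueParam_le (hX : IsPBanach 𝕜 p N)
    (hF : IsFundamentalMinimalSystem N x xs) (hb : IsBoundedSystem N x xs) (hp : 0 < p)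
    {m : ℕ} (hm : 1 ≤ m) :
    chebyshevLebesgueParam N x xs m ≤ ENNReal.ofReal ((2 + 2 ^ p / (2 ^ p - 1)) ^ (1 / p)) *
      max (quasiGreedyParam N x xs m) (squeezeSymmetryParam N x xs m) := by
  have h2 : (1 : ℝ) < 2 ^ p := Real.one_lt_rpow (by norm_num) hp
  have hK : 0 < 2 + 2 ^ p / ((2 : ℝ) ^ p - 1) :=
    add_pos_of_pos_of_nonneg zero_lt_two (div_nonneg (by positivity) (by linarith))
  set K : ℝ := (2 + 2 ^ p / (2 ^ p - 1)) ^ (1 / p) with hKdef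
  have hK0 : 0 < K := Real.rpow_pos_of_pos hK _
  set Q := max (quasiGreedyParam N x xs m) (squeezeSymmetryParam N x xs m) with hQ
  by_cases hQt : Q = ⊤
  · rw [hQt, ENNReal.mul_top (by simpa using hK0)]
    exact le_top
  have hQR : Q = ENNReal.ofReal Q.toReal := (ENNReal.ofReal_toReal hQt).symm
  have hQ1 : 1 ≤ Q := (one_le_quasiGreedyParam hX hF hm).trans (le_max_left _ _)
  have hR : 1 ≤ Q.toReal := by
    simpa using ENNReal.toReal_mono hQt hQ1
  refine sInf_le fun f => ?_
  -- A finite nonzero factor can be moved inside the infima defining the best error.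
  have hne : ENNReal.ofReal K * Q ≠ ⊤ := ENNReal.mul_ne_top ENNReal.ofReal_ne_top hQt
  have hne0 : ENNReal.ofReal K * Q ≠ 0 :=
    mul_ne_zero (by simpa using hK0) (zero_lt_one.trans_le hQ1).ne'
  rw [bestTermError, ENNReal.mul_iInf_of_ne hne0 hne]
  refine le_iInf fun y => ?_
  rw [ENNReal.mul_iInf_of_ne hne0 hne]
  refine le_iInf fun hy => ?_
  obtain ⟨a, ha⟩ := exists_chebyshev_approx hX hF hb hp hm hR
    (hQR ▸ le_max_left _ _) (hQR ▸ le_max_right _ _) f y hy.1 hy.2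
  refine (iInf_le _ a).trans ?_
  rw [hQR, ← ENNReal.ofReal_mul hK0.le, ← ENNReal.ofReal_mul (by positivity)]
  exact ENNReal.ofReal_le_ofReal ha

end CoefficientBounds

theorem theorem1p8 (p : ℝ) (hp0 : 0 < p) (hp1 : p ≤ 1) :
    ∃ C : ℝ≥0, ∀ (𝕜 : Type*) [RCLike 𝕜] (X : Type*) [AddCommGroup X] [Module 𝕜 X]
      (N : X → ℝ) (x : ℕ → X) (xs : ℕ → X →ₗ[𝕜] 𝕜),
      IsPBanach 𝕜 p N → IsFundamentalMinimalSystem N x xs → IsBoundedSystem N x xs →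
      ∀ m : ℕ, 1 ≤ m →
        (p = 1 → chebyshevLebesgueParam N x xs m ≤
          C * max (quasiGreedyParam N x xs m) (squeezeSymmetryParam N x xs m)) ∧
        (p < 1 → chebyshevLebesgueParam N x xs m ≤
          C * max (quasiGreedyParam N x xs m ^ (1 + 1 / p)) (squeezeSymmetryParam N x xs m)) := by
  refine ⟨((2 + 2 ^ p / (2 ^ p - 1)) ^ (1 / p) : ℝ).toNNReal, ?_⟩
  intro 𝕜 _ X _ _ N x xs hX hF hb m hm
  have hlin := chebyshevLebesgueParam_le hX hF hb hp0 hm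
  refine ⟨fun _ => hlin, fun _ => hlin.trans ?_⟩
  refine mul_le_mul_right (max_le_max ?_ le_rfl) _
  exact ENNReal.le_rpow_self_of_one_le (one_le_quasiGreedyParam hX hF hm)
    (le_add_of_nonneg_right (one_div_nonneg.2 hp0.le))
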